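/- Let $G_v$ denote the link of a vertex $v$ in a finite simple graph $G$, i.e. the subgraph of $G$ induced by the neighbours of $v$. For integers $a>b\ge 0$, $G$ is called $(a,b)$-regular if $G$ is $a$-regular and every $G_v$ is $b$-regular. A graph $H$ has edge expansion at least $\delta$ if $|E_H(U,V(H)\setminus U)|\ge\delta\min(|U|,|V(H)\setminus U|)$ for every $U\subseteq V(H)$. Let $\lambda_2(G)$ be the second largest eigenvalue (with multiplicity) of the adjacency matrix of $G$. There is a function $\epsilon(a,b,\delta)$, defined for integers $a>b\ge 0$ and real $\delta>0$, with the following properties. (1) $\epsilon(a,b,\delta)>0$ for all $a>b\ge0$ and $\delta>0$, and for every $(a,b)$-regular graph $G$ on $n$ vertices all of whose links have edge expansion at least $\delta$ (where, if $a=b+2$, we assume in addition that $G$ is connected) $$\lambda_2(G)\ \ge\ \left(b+2\sqrt{a-b-1}\right)\left(1+\epsilon(a,b,\delta)\right)-o_n(1),$$ where $o_n(1)$ is a function of $n$ that tends to $0$ as $n\to\infty$ and depends only on $a,b,\delta$. (2) If $b\ge2$ and $a\ge b+3$, then $\epsilon$ is given by $$1+\epsilon(a,b,\delta)=\left(1+\frac{r}{c^2}\right)^{\beta^2}\left(1-\frac{r}{bc^2}\right)^{\beta(1-2\beta)},$$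 where $c=\sqrt{a-b-1}$, $\beta=\frac{c}{b+2c}$ and $r=\min\left(\delta\cdot\min(b+1,a-b-1),\ \frac{b(c^3-c^2)}{b+c}\right)$. (3) If $a\ge b^2+5b+5$, then $\epsilon(a,b,\delta)$ is strictly increasing in $\delta\in(0,b]$ (a $b$-regular graph on at least two vertices has edge expansion at most $b$, so this range contains all values of $\delta$ that can occur). (4) For all $a>b\ge0$ there is $\delta_0=\delta_0(a,b)>0$ such that $\epsilon(a,b,\delta)$ is strictly increasing in $\delta\in(0,\delta_0)$. -/

import Mathlib

namespace LocalGlobal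

open Finset

/-- The link of `v` in `G`: the subgraph of `G` induced by the neighbours of `v`. -/
abbrev link {V : Type*} (G : SimpleGraph V) (v : V) : SimpleGraph (G.neighborSet v) :=
  G.induce (G.neighborSet v)

open Classical in
/-- `G` is `(a, b)`-regular: it is `a`-regular and all its links are `b`-regular. -/
def IsABRegular {V : Type*} [Fintype V] (G : SimpleGraph V) (a b : ℕ) : Prop :=
  G.IsRegularOfDegree a ∧ ∀ v : V, (link G v).IsRegularOfDegree b

open Classical in
/-- `|E(U, V \ U)| ≥ δ * min(|U|, |V \ U|)` for every set `U` of vertices. In `interedges U Uᶜ`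
every edge between `U` and its complement occurs exactly once, as a pair in `U × Uᶜ`. -/
def IsEdgeExpander {V : Type*} [Fintype V] (G : SimpleGraph V) (δ : ℝ) : Prop :=
  ∀ U : Finset V, δ * min (#U : ℝ) (#Uᶜ : ℝ) ≤ (#(G.interedges U Uᶜ) : ℝ)

open Classical in
/-- All links of `G` have edge expansion at least `δ`. -/
def LinksExpand {V : Type*} [Fintype V] (G : SimpleGraph V) (δ : ℝ) : Prop :=
  ∀ v : V, IsEdgeExpander (link G v) δ

open Classical in
/-- The second largest eigenvalue, with multiplicity, of the adjacency matrix
(`eigenvalues₀` lists the eigenvalues in decreasing order, indexed from `0`);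
the value is `0` by convention if `G` has fewer than two vertices. -/
noncomputable def secondEigenvalue {V : Type*} [Fintype V] (G : SimpleGraph V) : ℝ :=
  if h : 1 < Fintype.card V then (G.isHermitian_adjMatrix ℝ).eigenvalues₀ ⟨1, h⟩ else 0

/-- `c = √(a - b - 1)`. -/
noncomputable def cParam (a b : ℕ) : ℝ := √((a : ℝ) - b - 1)

/-- `r = min (δ * min (b + 1, a - b - 1), b * (c ^ 3 - c ^ 2) / (b + c))`. -/
noncomputable def rParam (a b : ℕ) (δ : ℝ) : ℝ :=
  min (δ * min ((b : ℝ) + 1) ((a : ℝ) - b - 1))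
    (b * (cParam a b ^ 3 - cParam a b ^ 2) / (b + cParam a b))

/-- `Δ = β ^ 2 * log (1 + r / c ^ 2) + β * (1 - 2 * β) * log (1 - r / (b * c ^ 2))`
with `β = c / (b + 2 * c)`. -/
noncomputable def gain (a b : ℕ) (δ : ℝ) : ℝ :=
  let c := cParam a b
  let r := rParam a b δ
  let β := c / (b + 2 * c)
  β ^ 2 * Real.log (1 + r / c ^ 2) + β * (1 - 2 * β) * Real.log (1 - r / (b * c ^ 2))

end LocalGlobal

universe u

namespace LocalGlobal

open Finset

/-! ### Analytic estimates -/

/-! Let A be the adjacency matrix. Two nonnegative nonzero functions with disjoint, nonadjacent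
supports and A f ≥ l f pointwise span a plane on which the quadratic form of A is at least l times
the square norm, so λ₂ ≥ l (`le_secondEigenvalue`). Such functions live on balls around two far
apart vertices, which exist for large n because balls have bounded size.

A profile Y of the distance to the root gives rate about b + 2c: in the worst case a vertex has one
neighbour below it, b level with it and c² above. Expansion of the link of x forces many edges
between the neighbours of x above it and the others, so vertices above x have extra neighbours below
them. `testFun` pays a bonus (Y (d - 1) - Y d) / Λ for each extra lower neighbour; since l ≤ Λ,
these neighbours cover the cost of the bonus at the vertex itself. The net effect (`mul_testFun_le`)
is to move weight s = r / Λ in the recurrence from the upper term to the level term, for a rate b +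
s + 2√(c² - s), up to a loss vanishing with the radius (`exists_profile`).

That Λ = (b + 2c) exp(gain) is at most this rate (`le_add_two_sqrt`) follows from Jensen's
inequality on the two rows of a tilted transfer matrix (`sq_le_of_log_eq`).

Outside 2 ≤ b, b + 3 ≤ a, either the graph is a disjoint union of cliques or its order is bounded,
so ε can be chosen by hand. -/

/-- Weighted Jensen inequality for the logarithm, three points. -/
lemma log_weighted_mean_three {w₁ w₂ w₃ x₁ x₂ x₃ : ℝ} (hw₁ : 0 < w₁) (hw₂ : 0 < w₂)
    (hw₃ : 0 < w₃) (hw : w₁ + w₂ + w₃ = 1) (hx₁ : 0 < x₁) (hx₂ : 0 < x₂) (hx₃ : 0 < x₃) :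
    w₁ * Real.log x₁ + w₂ * Real.log x₂ + w₃ * Real.log x₃
      ≤ Real.log (w₁ * x₁ + w₂ * x₂ + w₃ * x₃) := by
  set S := w₁ * x₁ + w₂ * x₂ + w₃ * x₃ with hS
  have hSpos : 0 < S := by positivity
  have key : ∀ w x : ℝ, 0 < w → 0 < x → w * Real.log x ≤ w * Real.log S + (w * x / S - w) := by
    intro w x hw hx
    have h := Real.log_le_sub_one_of_pos (div_pos hx hSpos)
    rw [Real.log_div hx.ne' hSpos.ne'] at h
    have h2 := mul_le_mul_of_nonneg_left h hw.le
    have h3 : w * x / S = w * (x / S) := by ring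
    rw [h3]
    linarith
  have h₁ := key w₁ x₁ hw₁ hx₁
  have h₂ := key w₂ x₂ hw₂ hx₂
  have h₃ := key w₃ x₃ hw₃ hx₃
  have h₄ : w₁ * x₁ / S + w₂ * x₂ / S + w₃ * x₃ / S = 1 := by
    rw [← add_div, ← add_div, ← hS, div_self hSpos.ne']
  have h₅ : w₁ * Real.log S + w₂ * Real.log S + w₃ * Real.log S = Real.log S := by
    rw [← add_mul, ← add_mul, hw, one_mul]
  linarith

/-- The quadratic inequality satisfied by the weighted geometric mean `P ^ (β²) * Q ^ (β (1 - 2β))`,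
which compares it with the Perron root of a `2 × 2` transfer matrix tilted by `ζ`. -/
lemma sq_le_of_log_eq {β P Q ζ x : ℝ} (hβ : 0 < β) (hβ' : 2 * β < 1) (hP : 0 < P) (hQ : 0 < Q)
    (hζ : 1 ≤ ζ) (hx : 1 ≤ x)
    (hlog : Real.log x = β ^ 2 * Real.log P + β * (1 - 2 * β) * Real.log Q) :
    x ^ 2 ≤ x * (1 - 2 * β + β / ζ + β * ζ) + β ^ 2 * (P - 1)
      - β * ζ * ((1 - 2 * β) * (1 - Q)) := by
  have hζ0 : 0 < ζ := by linarith
  have hβζ : β / ζ ≤ β := div_le_self hβ.le hζ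
  have hnum : 0 < x - (1 - 2 * β) - β / ζ := by linarith
  -- u makes the weighted mean in the first row exactly x.
  set u := (x - (1 - 2 * β) - β / ζ) / (β * ζ) with hu
  have hu0 : 0 < u := by positivity
  have hux : β * (ζ * u) = x - (1 - 2 * β) - β / ζ := by
    rw [hu]; field_simp
  have hb : 0 < 1 - 2 * β := by linarith
  have hsum : (1 - 2 * β) + β + β = 1 := by ring
  have row₁ := log_weighted_mean_three hb hβ hβ hsum one_pos (inv_pos.2 hζ0) (mul_pos hζ0 hu0)
  have row₂ := log_weighted_mean_three hb hβ hβ hsum hQ (mul_pos hP (inv_pos.2 hζ0))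
    (mul_pos hζ0 hu0)
  rw [hux, Real.log_one, Real.log_inv, Real.log_mul hζ0.ne' hu0.ne'] at row₁
  have e₁ : (1 - 2 * β) * 1 + β * ζ⁻¹ + (x - (1 - 2 * β) - β / ζ) = x := by
    rw [div_eq_mul_inv]; ring
  rw [e₁] at row₁
  set T := (1 - 2 * β) * Q + β * (P * ζ⁻¹) + β * (ζ * u) with hT
  rw [Real.log_mul hP.ne' (inv_pos.2 hζ0).ne', Real.log_inv, Real.log_mul hζ0.ne' hu0.ne'] at row₂
  have hTpos : 0 < T := by positivity
  have hxu : Real.log (x * u) ≤ Real.log T := by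
    rw [Real.log_mul (by linarith) hu0.ne']
    -- The weights 1 - β and β turn the P and Q terms into log x through `hlog`; log ζ has already
    -- cancelled within each row.
    have r₁ := mul_le_mul_of_nonneg_left row₁ (by linarith : 0 ≤ 1 - β)
    have r₂ := mul_le_mul_of_nonneg_left row₂ hβ.le
    have : β * (Real.log x + Real.log u) ≤ β * Real.log T := by nlinarith
    exact le_of_mul_le_mul_left this hβ
  have hle : x * u ≤ T := (Real.log_le_log_iff (by positivity) hTpos).1 hxu
  have h2 := mul_le_mul_of_nonneg_left hle (by positivity : 0 ≤ β * ζ)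
  have e₂ : β * ζ * (x * u) = x * (x - (1 - 2 * β) - β / ζ) := by rw [← hux]; ring
  have e₃ : β * ζ * T = β * ζ * ((1 - 2 * β) * Q) + β ^ 2 * P
      + β * ζ * (x - (1 - 2 * β) - β / ζ) := by
    rw [hT, hux]; field_simp
  have e₄ : β * ζ * (β / ζ) = β ^ 2 := by field_simp
  rw [e₂, e₃] at h2
  nlinarith

/-- `gain` as a function of the parameters `b`, `c` and `r`. -/
noncomputable def gainFun (b c r : ℝ) : ℝ :=
  (c / (b + 2 * c)) ^ 2 * Real.log (1 + r / c ^ 2)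
    + c / (b + 2 * c) * (1 - 2 * (c / (b + 2 * c))) * Real.log (1 - r / (b * c ^ 2))

lemma gain_eq_gainFun (a b : ℕ) (δ : ℝ) :
    gain a b δ = gainFun b (cParam a b) (rParam a b δ) := rfl

lemma gainFun_zero (b c : ℝ) : gainFun b c 0 = 0 := by simp [gainFun]

lemma lt_mul_sq_of_le_cap {b c r : ℝ} (hb : 0 < b) (hc : 1 < c)
    (hr : r ≤ b * (c ^ 3 - c ^ 2) / (b + c)) : r < b * c ^ 2 := by
  refine hr.trans_lt ?_
  rw [div_lt_iff₀ (by linarith)]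
  have : 0 < b * c ^ 2 := by positivity
  nlinarith

/-- The derivative has the sign of c / (c² + r) - b / (b c² - r), which is nonnegative exactly when
r (b + c) ≤ b (c³ - c²); this is the origin of the cap in `rParam`. The inequality log t ≤ t - 1,
strict for t ≠ 1, replaces differentiation. -/
lemma gainFun_strictMonoOn {b c : ℝ} (hb : 0 < b) (hc : 1 < c) :
    StrictMonoOn (gainFun b c) (Set.Icc 0 (b * (c ^ 3 - c ^ 2) / (b + c))) := by
  intro r₁ h₁ r₂ h₂ h12
  have hc0 : 0 < c := by linarith
  have hr₁ := lt_mul_sq_of_le_cap hb hc h₁.2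
  have hr₂ := lt_mul_sq_of_le_cap hb hc h₂.2
  have hcap : r₂ * (b + c) ≤ b * (c ^ 3 - c ^ 2) := by
    have := h₂.2
    rwa [le_div_iff₀ (by linarith)] at this
  have h10 := h₁.1
  have h20 := h₂.1
  have hc2 : 0 < c ^ 2 := by positivity
  have hp₁ : 0 < c ^ 2 + r₁ := by linarith
  have hp₂ : 0 < c ^ 2 + r₂ := by linarith
  have hq₁ : 0 < b * c ^ 2 - r₁ := by linarith
  have hq₂ : 0 < b * c ^ 2 - r₂ := by linarith
  have hβ : 0 < c / (b + 2 * c) := by positivity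
  have hβ' : 1 - 2 * (c / (b + 2 * c)) = b / (b + 2 * c) := by field_simp; ring
  have eP : ∀ r, 1 + r / c ^ 2 = (c ^ 2 + r) / c ^ 2 := by intro r; field_simp
  have eQ : ∀ r, 1 - r / (b * c ^ 2) = (b * c ^ 2 - r) / (b * c ^ 2) := by
    intro r; field_simp
  have hbc : 0 < b * c ^ 2 := by positivity
  simp only [gainFun, eP, eQ, hβ']
  rw [Real.log_div hp₁.ne' hc2.ne', Real.log_div hp₂.ne' hc2.ne',
    Real.log_div hq₁.ne' hbc.ne', Real.log_div hq₂.ne' hbc.ne']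
  have l₁ : Real.log (c ^ 2 + r₁) - Real.log (c ^ 2 + r₂) < -((r₂ - r₁) / (c ^ 2 + r₂)) := by
    rw [← Real.log_div hp₁.ne' hp₂.ne']
    have := Real.log_lt_sub_one_of_pos (div_pos hp₁ hp₂)
      (by rw [Ne, div_eq_one_iff_eq hp₂.ne']; intro h; linarith)
    refine this.trans_eq ?_
    field_simp; ring
  have l₂ : Real.log (b * c ^ 2 - r₁) - Real.log (b * c ^ 2 - r₂)
      ≤ (r₂ - r₁) / (b * c ^ 2 - r₂) := by
    rw [← Real.log_div hq₁.ne' hq₂.ne']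
    refine (Real.log_le_sub_one_of_pos (div_pos hq₁ hq₂)).trans_eq ?_
    field_simp; ring
  have l₃ : b / (b + 2 * c) * ((r₂ - r₁) / (b * c ^ 2 - r₂))
      ≤ c / (b + 2 * c) * ((r₂ - r₁) / (c ^ 2 + r₂)) := by
    rw [div_mul_div_comm, div_mul_div_comm, div_le_div_iff₀ (by positivity) (by positivity)]
    have h0 : 0 ≤ (r₂ - r₁) * (b + 2 * c) := mul_nonneg (by linarith) (by linarith)
    have h1 : b * (c ^ 2 + r₂) ≤ c * (b * c ^ 2 - r₂) := by nlinarith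
    nlinarith [mul_le_mul_of_nonneg_left h1 h0]
  have m₁ := mul_lt_mul_of_pos_left l₁ (mul_pos hβ hβ)
  have m₂ := mul_le_mul_of_nonneg_left l₂
    (by positivity : 0 ≤ c / (b + 2 * c) * (b / (b + 2 * c)))
  have m₃ := mul_le_mul_of_nonneg_left l₃ hβ.le
  set β := c / (b + 2 * c)
  set β' := b / (b + 2 * c)
  nlinarith

/-- The main analytic estimate: `Λ = (b + 2c) exp (gain)` is at most
`b + s + 2 √(c² - s)` with `s = r / Λ`. -/
lemma le_add_two_sqrt {b c r Λ : ℝ} (hb : 0 < b) (hc : 1 < c) (hr : 0 ≤ r)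
    (hr' : r ≤ b * (c ^ 3 - c ^ 2) / (b + c)) (hΛ : Λ = (b + 2 * c) * Real.exp (gainFun b c r)) :
    b + 2 * c ≤ Λ ∧ r / Λ < c ^ 2 ∧ Λ ≤ b + r / Λ + 2 * √(c ^ 2 - r / Λ) := by
  have hc0 : 0 < c := by linarith
  have hL : 0 < b + 2 * c := by linarith
  have hcap : 0 ≤ b * (c ^ 3 - c ^ 2) / (b + c) := hr.trans hr'
  have hg : 0 ≤ gainFun b c r := by
    rw [← gainFun_zero b c]
    exact (gainFun_strictMonoOn hb hc).monotoneOn ⟨le_rfl, hcap⟩ ⟨hr, hr'⟩ hr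
  have hx : 1 ≤ Real.exp (gainFun b c r) := Real.one_le_exp hg
  have hlog : Real.log (Real.exp (gainFun b c r)) = gainFun b c r := Real.log_exp _
  set x := Real.exp (gainFun b c r) with hxdef
  have hΛL : b + 2 * c ≤ Λ := by rw [hΛ]; nlinarith
  have hΛ0 : 0 < Λ := by linarith
  have hrlt := lt_mul_sq_of_le_cap hb hc hr'
  have hs : r / Λ < c ^ 2 := by
    rw [div_lt_iff₀ hΛ0]
    have : 0 < c ^ 2 := by positivity
    nlinarith
  refine ⟨hΛL, hs, ?_⟩
  set s := r / Λ with hsdef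
  have hs0 : 0 ≤ s := div_nonneg hr hΛ0.le
  set k := √(c ^ 2 - s) with hk
  have hk0 : 0 < k := Real.sqrt_pos.2 (by linarith)
  have hk2 : k ^ 2 = c ^ 2 - s := Real.sq_sqrt (by linarith)
  have hkc : k ≤ c := by nlinarith
  have hsΛ : s * Λ = r := by rw [hsdef]; field_simp
  have hβ0 : 0 < c / (b + 2 * c) := by positivity
  have hβ' : 2 * (c / (b + 2 * c)) < 1 := by
    rw [← mul_div_assoc, div_lt_one hL]; linarith
  have hP : 0 < 1 + r / c ^ 2 := by positivity
  have hQ : 0 < 1 - r / (b * c ^ 2) := by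
    rw [sub_pos, div_lt_one (by positivity)]; exact hrlt
  -- With the tilt ζ = c / k, substituting r = s Λ and c² = k² + s collapses the quadratic
  -- inequality to Λ² ≤ Λ (b + s + 2k).
  have key := sq_le_of_log_eq hβ0 hβ' hP hQ ((one_le_div hk0).2 hkc) hx hlog
  have e₁ : 1 - 2 * (c / (b + 2 * c)) + c / (b + 2 * c) / (c / k) + c / (b + 2 * c) * (c / k)
      = (b + k + c ^ 2 / k) / (b + 2 * c) := by field_simp; ring
  have e₂ : (c / (b + 2 * c)) ^ 2 * (1 + r / c ^ 2 - 1) = r / (b + 2 * c) ^ 2 := by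
    field_simp; ring
  have e₃ : c / (b + 2 * c) * (c / k) * ((1 - 2 * (c / (b + 2 * c))) * (1 - (1 - r / (b * c ^ 2))))
      = r / k / (b + 2 * c) ^ 2 := by
    field_simp; ring
  rw [e₁, e₂, e₃] at key
  have h2 := mul_le_mul_of_nonneg_left key (by positivity : 0 ≤ (b + 2 * c) ^ 2)
  have e₄ : (b + 2 * c) ^ 2 * x ^ 2 = Λ ^ 2 := by rw [hΛ]; ring
  have e₅ : (b + 2 * c) ^ 2 * (x * ((b + k + c ^ 2 / k) / (b + 2 * c)) + r / (b + 2 * c) ^ 2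
      - r / k / (b + 2 * c) ^ 2) = Λ * (b + k + c ^ 2 / k) + r - r / k := by
    rw [hΛ]; field_simp
  rw [e₄, e₅] at h2
  have e₆ : Λ * (b + k + c ^ 2 / k) + r - r / k = Λ * (b + s + 2 * k) := by
    rw [← hsΛ, show c ^ 2 = k ^ 2 + s by linarith]; field_simp; ring
  rw [e₆, sq] at h2
  exact le_of_mul_le_mul_left h2 hΛ0

/-- A finitely supported antitone profile that is a subsolution of a three-term recurrence. -/
lemma exists_profile {B k l : ℝ} (R : ℕ) (hR : 2 ≤ R) (hk : 0 < k)
    (hl : l ≤ B + 2 * k * Real.cos (Real.pi / R)) (hl' : l ≤ 1 + B + k ^ 2) :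
    ∃ Y : ℕ → ℝ, Antitone Y ∧ (∀ i, R ≤ i → Y i = 0) ∧ 0 < Y 0 ∧ Y 0 = Y 1 ∧
      ∀ i, l * Y (i + 1) ≤ Y i + B * Y (i + 1) + k ^ 2 * Y (i + 2) := by
  have hR0 : (0 : ℝ) < R := by exact_mod_cast (by omega : 0 < R)
  set θ := Real.pi / R with hθ
  have hθ0 : 0 < θ := div_pos Real.pi_pos hR0
  have hθR : R * θ = Real.pi := by rw [hθ]; field_simp
  -- An exact solution at rate B + 2k cos θ, cut off at its zero m = R.
  let y : ℕ → ℝ := fun m => if m ≤ R then k⁻¹ ^ m * Real.sin (m * θ) else 0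
  have hy0 : ∀ m, 0 ≤ y m := by
    intro m
    by_cases h : m ≤ R
    · simp only [y, if_pos h]
      have : (m : ℝ) ≤ R := by exact_mod_cast h
      exact mul_nonneg (by positivity)
        (Real.sin_nonneg_of_nonneg_of_le_pi (by positivity) (by rw [← hθR]; gcongr))
    · simp [y, h]
  have hyR : ∀ m, R ≤ m → y m = 0 := by
    intro m h
    rcases h.eq_or_lt with rfl | h
    · simp [y, hθR]
    · simp [y, not_le.2 h]
  have hrec : ∀ i, l * y (i + 1) ≤ y i + B * y (i + 1) + k ^ 2 * y (i + 2) := by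
    intro i
    by_cases h : i + 2 ≤ R
    · have h1 : y (i + 1) = k⁻¹ ^ (i + 1) * Real.sin ((i + 1) * θ) := by
        simp only [y, if_pos (by omega : i + 1 ≤ R)]; push_cast; ring_nf
      have h2 : y i + k ^ 2 * y (i + 2) = 2 * k * Real.cos θ * y (i + 1) := by
        have s1 : Real.sin (i * θ) = Real.sin ((i + 1) * θ) * Real.cos θ
            - Real.cos ((i + 1) * θ) * Real.sin θ := by
          rw [← Real.sin_sub]; ring_nf
        have s2 : Real.sin ((i + 2) * θ) = Real.sin ((i + 1) * θ) * Real.cos θ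
            + Real.cos ((i + 1) * θ) * Real.sin θ := by
          rw [← Real.sin_add]; ring_nf
        rw [h1]
        simp only [y, if_pos h, if_pos (by omega : i ≤ R)]
        push_cast
        rw [s1, s2, pow_add, pow_add]
        field_simp
        ring
      have := mul_le_mul_of_nonneg_right hl (hy0 (i + 1))
      linarith
    · rw [hyR (i + 1) (by omega)]
      have := hy0 i
      have := mul_nonneg (sq_nonneg k) (hy0 (i + 2))
      linarith
  -- A running maximum from the right end: Y becomes the least antitone majorant of y.
  let Z : ℕ → ℝ := fun j => Nat.rec 0 (fun j z => max (y (R - (j + 1))) z) j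
  let Y : ℕ → ℝ := fun i => Z (R - i)
  have hYR : ∀ i, R ≤ i → Y i = 0 := by
    intro i h
    simp [Y, Z, Nat.sub_eq_zero_of_le h]
  have hY : ∀ i, Y i = max (y i) (Y (i + 1)) := by
    intro i
    by_cases h : i < R
    · obtain ⟨j, hj⟩ : ∃ j, R - i = j + 1 := ⟨R - i - 1, by omega⟩
      have h1 : Y i = max (y (R - (j + 1))) (Z j) := by simp only [Y, hj, Z]
      have h2 : Y (i + 1) = Z j := by simp only [Y, show R - (i + 1) = j by omega]
      rw [h1, h2, show R - (j + 1) = i by omega]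
    · rw [hYR i (by omega), hYR (i + 1) (by omega), hyR i (by omega), max_self]
  have hle : ∀ i, y i ≤ Y i := fun i => (le_max_left _ _).trans (hY i).ge
  have hanti : Antitone Y := antitone_nat_of_succ_le fun i => (le_max_right _ _).trans (hY i).ge
  have hYnn : ∀ i, 0 ≤ Y i := fun i => (hy0 i).trans (hle i)
  have h01 : Y 0 = Y 1 := by
    rw [hY 0, max_eq_right]
    simpa [y] using hYnn 1
  refine ⟨Y, hanti, hYR, ?_, h01, ?_⟩
  · rw [h01]
    refine lt_of_lt_of_le ?_ (hle 1)
    simp only [y, if_pos (by omega : 1 ≤ R)]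
    refine mul_pos (by positivity) (Real.sin_pos_of_pos_of_lt_pi (by simpa using hθ0) ?_)
    rw [← hθR]
    have : (1 : ℝ) < R := by exact_mod_cast (by omega : 1 < R)
    push_cast
    gcongr
  · intro i
    -- Where Y touches y the recurrence of y applies; on a plateau l ≤ 1 + B + k² suffices.
    rcases le_total (Y (i + 2)) (y (i + 1)) with h | h
    · have h1 : Y (i + 1) = y (i + 1) := by rw [hY, max_eq_left h]
      rw [h1]
      have := mul_le_mul_of_nonneg_left (hle (i + 2)) (sq_nonneg k)
      linarith [hrec i, hle i]
    · have h1 : Y (i + 1) = Y (i + 2) := by rw [hY (i + 1), max_eq_right h]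
      rw [← h1]
      have := mul_le_mul_of_nonneg_right hl' (hYnn (i + 1))
      linarith [hanti (Nat.le_succ i)]

/-! ### Lower bounds for the second eigenvalue -/

section Spectral

variable {V : Type*} [Fintype V]

/-- An eigenvalue of a symmetric real matrix, other than a fixed one, is at least a lower bound of
the quadratic form on a plane. -/
lemma exists_eigenvalue_ge [DecidableEq V] {A : Matrix V V ℝ} (hA : A.IsHermitian) (i₀ : V)
    {l : ℝ} {f₁ f₂ : V → ℝ}
    (hindep : ∀ s t : ℝ, s • f₁ + t • f₂ = 0 → s = 0 ∧ t = 0)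
    (hform : ∀ s t : ℝ, l * ((s • f₁ + t • f₂) ⬝ᵥ (s • f₁ + t • f₂))
      ≤ (s • f₁ + t • f₂) ⬝ᵥ (A.mulVec (s • f₁ + t • f₂))) :
    ∃ i, i ≠ i₀ ∧ l ≤ hA.eigenvalues i := by
  by_contra! hlt
  set e : V → V → ℝ := fun i => ⇑(hA.eigenvectorBasis i) with he
  -- A plane always contains a nonzero vector orthogonal to one given eigenvector.
  obtain ⟨s, t, hst, hst0⟩ : ∃ s t : ℝ, (s • f₁ + t • f₂ ≠ 0) ∧
      e i₀ ⬝ᵥ (s • f₁ + t • f₂) = 0 := by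
    by_cases h : e i₀ ⬝ᵥ f₁ = 0
    · refine ⟨1, 0, fun h0 => one_ne_zero (hindep 1 0 h0).1, ?_⟩
      simp [h]
    · refine ⟨-(e i₀ ⬝ᵥ f₂), e i₀ ⬝ᵥ f₁, fun h0 => h (hindep _ _ h0).2, ?_⟩
      simp only [dotProduct_add, dotProduct_smul, smul_eq_mul]
      ring
  set g := s • f₁ + t • f₂ with hg
  have hpars : ∀ x y : V → ℝ, x ⬝ᵥ y = ∑ i, (e i ⬝ᵥ x) * (e i ⬝ᵥ y) := by
    intro x y
    have h := hA.eigenvectorBasis.sum_inner_mul_inner (WithLp.toLp 2 x) (WithLp.toLp 2 y)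
    simp only [EuclideanSpace.inner_eq_star_dotProduct, star_trivial] at h
    rw [dotProduct_comm x y, ← h]
    refine Finset.sum_congr rfl fun i _ => ?_
    rw [dotProduct_comm y]
  have heig : ∀ i, e i ⬝ᵥ (A.mulVec g) = hA.eigenvalues i * (e i ⬝ᵥ g) := by
    intro i
    rw [Matrix.dotProduct_mulVec, ← Matrix.mulVec_transpose,
      show A.transpose = A by rw [← Matrix.conjTranspose_eq_transpose_of_trivial]; exact hA]
    have := hA.mulVec_eigenvectorBasis i
    simp only [he]
    rw [this, smul_dotProduct, smul_eq_mul]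
  have hne : ∃ i, e i ⬝ᵥ g ≠ 0 := by
    by_contra! h
    refine hst (dotProduct_self_eq_zero.1 ?_)
    rw [hpars]
    simp [h]
  obtain ⟨j, hj⟩ := hne
  have hle := hform s t
  rw [← hg, hpars g g, hpars g (A.mulVec g), Finset.mul_sum] at hle
  refine absurd hle (not_le.2 (Finset.sum_lt_sum (fun i _ => ?_) ⟨j, Finset.mem_univ j, ?_⟩))
  · rw [heig]
    by_cases hi : i = i₀
    · rw [hi, hst0]; simp
    · nlinarith [hlt i hi, mul_self_nonneg (e i ⬝ᵥ g)]
  · have hji : j ≠ i₀ := fun h => hj (h ▸ hst0)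
    rw [heig]
    nlinarith [hlt j hji, mul_self_pos.2 hj]

open Classical in
/-- Two nonnegative nonzero functions with nonadjacent supports on which the adjacency matrix acts
with growth at least `l` bound the second eigenvalue from below by `l`. -/
lemma le_secondEigenvalue (G : SimpleGraph V) {l : ℝ} {f₁ f₂ : V → ℝ} {v₁ v₂ : V}
    (h₁ : ∀ x, 0 ≤ f₁ x) (h₂ : ∀ x, 0 ≤ f₂ x) (hv₁ : 0 < f₁ v₁) (hv₂ : 0 < f₂ v₂)
    (hl₁ : ∀ x, l * f₁ x ≤ ∑ y ∈ G.neighborFinset x, f₁ y)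
    (hl₂ : ∀ x, l * f₂ x ≤ ∑ y ∈ G.neighborFinset x, f₂ y)
    (hdisj : ∀ x, f₁ x * f₂ x = 0) (hadj : ∀ x y, G.Adj x y → f₁ x * f₂ y = 0) :
    l ≤ secondEigenvalue G := by
  have hne : v₁ ≠ v₂ := by
    rintro rfl
    exact (mul_pos hv₁ hv₂).ne' (hdisj v₁)
  have hcard : 1 < Fintype.card V := Fintype.one_lt_card_iff.2 ⟨v₁, v₂, hne⟩
  set A := G.adjMatrix ℝ with hAdef
  have hA := G.isHermitian_adjMatrix ℝ
  have hmul : ∀ (f : V → ℝ) x, A.mulVec f x = ∑ y ∈ G.neighborFinset x, f y := by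
    intro f x
    rw [hAdef, SimpleGraph.adjMatrix_mulVec_apply]
  have hz₁ : f₁ v₂ = 0 := (mul_eq_zero.1 (hdisj v₂)).resolve_right hv₂.ne'
  have hz₂ : f₂ v₁ = 0 := (mul_eq_zero.1 (hdisj v₁)).resolve_left hv₁.ne'
  have hself : ∀ f : V → ℝ, (∀ x, 0 ≤ f x) → (∀ x, l * f x ≤ ∑ y ∈ G.neighborFinset x, f y) →
      l * (f ⬝ᵥ f) ≤ f ⬝ᵥ (A.mulVec f) := by
    intro f hf hlf
    simp only [dotProduct, Finset.mul_sum]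
    refine Finset.sum_le_sum fun x _ => ?_
    rw [hmul]
    nlinarith [mul_le_mul_of_nonneg_left (hlf x) (hf x)]
  have hcross₁ : f₁ ⬝ᵥ (A.mulVec f₂) = 0 := by
    simp only [dotProduct, hmul, Finset.mul_sum]
    exact Finset.sum_eq_zero fun x _ => Finset.sum_eq_zero fun y hy =>
      hadj x y ((G.mem_neighborFinset x y).1 hy)
  have hcross₂ : f₂ ⬝ᵥ (A.mulVec f₁) = 0 := by
    simp only [dotProduct, hmul, Finset.mul_sum]
    refine Finset.sum_eq_zero fun x _ => Finset.sum_eq_zero fun y hy => ?_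
    rw [mul_comm]
    exact hadj y x ((G.mem_neighborFinset x y).1 hy).symm
  have hcross₃ : f₁ ⬝ᵥ f₂ = 0 := Finset.sum_eq_zero fun x _ => hdisj x
  -- The excluded index carries the largest eigenvalue, so any other eigenvalue is at most the
  -- second.
  obtain ⟨i, hi, hli⟩ := exists_eigenvalue_ge hA
    (Fintype.equivOfCardEq (Fintype.card_fin _) (⟨0, by omega⟩ : Fin (Fintype.card V)))
    (l := l) (f₁ := f₁) (f₂ := f₂)
    (by
      intro s t h
      have e₁ := congrFun h v₁
      have e₂ := congrFun h v₂
      simp only [Pi.add_apply, Pi.smul_apply, smul_eq_mul, Pi.zero_apply, hz₁, hz₂, mul_zero,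
        add_zero, zero_add, mul_eq_zero] at e₁ e₂
      exact ⟨e₁.resolve_right hv₁.ne', e₂.resolve_right hv₂.ne'⟩)
    (by
      intro s t
      rw [Matrix.mulVec_add, Matrix.mulVec_smul, Matrix.mulVec_smul]
      simp only [dotProduct_add, add_dotProduct, dotProduct_smul, smul_dotProduct, smul_eq_mul]
      rw [hcross₁, hcross₂, dotProduct_comm f₂ f₁, hcross₃]
      have q₁ := mul_le_mul_of_nonneg_left (hself f₁ h₁ hl₁) (mul_self_nonneg s)
      have q₂ := mul_le_mul_of_nonneg_left (hself f₂ h₂ hl₂) (mul_self_nonneg t)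
      nlinarith)
  rw [secondEigenvalue, dif_pos hcard]
  refine hli.trans (hA.eigenvalues₀_antitone ?_)
  rw [Fin.le_def]
  by_contra! h
  refine hi ?_
  rw [← Equiv.symm_apply_eq]
  ext
  simpa using h

open Classical in
/-- A crude lower bound for the second eigenvalue. -/
lemma neg_card_le_secondEigenvalue (G : SimpleGraph V) :
    -(Fintype.card V : ℝ) ≤ secondEigenvalue G := by
  rw [secondEigenvalue]
  split_ifs with h
  · have hA := G.isHermitian_adjMatrix ℝ
    set i := Fintype.equivOfCardEq (Fintype.card_fin _) (⟨1, h⟩ : Fin (Fintype.card V)) with hi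
    have hval : hA.eigenvalues₀ ⟨1, h⟩ = hA.eigenvalues i := by
      simp [Matrix.IsHermitian.eigenvalues, hi]
    have hmem := hA.eigenvalues_mem_spectrum_real i
    rw [← Matrix.spectrum_toLin', ← Module.End.hasEigenvalue_iff_mem_spectrum] at hmem
    obtain ⟨k, hk⟩ := eigenvalue_mem_ball hmem
    rw [hval]
    rw [Metric.mem_closedBall, Real.dist_eq] at hk
    simp only [SimpleGraph.adjMatrix_apply, SimpleGraph.irrefl, if_false, sub_zero] at hk
    have hsum : ∑ j ∈ Finset.univ.erase k, ‖(if G.Adj k j then (1 : ℝ) else 0)‖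
        ≤ Fintype.card V := by
      refine (Finset.sum_le_card_nsmul _ _ 1 fun j _ => ?_).trans ?_
      · split_ifs <;> simp
      · rw [nsmul_eq_mul, mul_one]
        exact_mod_cast Finset.card_le_univ _
    linarith [neg_abs_le (hA.eigenvalues i)]
  · simp

end Spectral

/-! ### Links in terms of neighbourhoods -/

section Links

variable {V : Type*} [Fintype V] {G : SimpleGraph V} {a b : ℕ} {δ : ℝ}

open Classical in
lemma IsABRegular.card_neighborFinset (h : IsABRegular G a b) (v : V) :
    #(G.neighborFinset v) = a := h.1 v

open Classical in
lemma IsABRegular.card_inter_neighborFinset (h : IsABRegular G a b) {v u : V} (hvu : G.Adj v u) :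
    #(G.neighborFinset v ∩ G.neighborFinset u) = b := by
  have hdeg := h.2 v ⟨u, hvu⟩
  rw [← SimpleGraph.card_neighborFinset_eq_degree,
    ← Finset.card_map (Function.Embedding.subtype _)] at hdeg
  rw [← hdeg]
  congr 1
  ext w
  simp [and_comm]

open Classical in
lemma LinksExpand.le_card_edges (h : LinksExpand G δ) (v : V) {S : Finset V}
    (hS : S ⊆ G.neighborFinset v) :
    δ * min (#S : ℝ) (#(G.neighborFinset v \ S) : ℝ)
      ≤ #{p ∈ S ×ˢ (G.neighborFinset v \ S) | G.Adj p.1 p.2} := by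
  have hU := h v (S.subtype (· ∈ G.neighborSet v))
  have h₁ : #(S.subtype (· ∈ G.neighborSet v)) = #S := by
    rw [Finset.card_subtype, Finset.filter_true_of_mem]
    intro x hx
    simpa using hS hx
  have h₂ : ∀ _ : DecidableEq (G.neighborSet v),
      #(S.subtype (· ∈ G.neighborSet v))ᶜ = #(G.neighborFinset v \ S) := by
    intro _
    rw [← Finset.card_map (Function.Embedding.subtype _)]
    congr 1
    ext w
    simp [and_comm]
  rw [h₁, h₂ _] at hU
  refine hU.trans ?_
  rw [Nat.cast_le]
  refine Finset.card_le_card_of_injOn (fun p => (p.1.1, p.2.1)) ?_ ?_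
  · rintro ⟨x, y⟩ hxy
    have hxy' := (SimpleGraph.mem_interedges_iff _).1 (Finset.mem_coe.1 hxy)
    have hy := y.2
    simp only [Finset.mem_subtype, Finset.mem_compl, SimpleGraph.comap_adj] at hxy'
    simp only [Finset.coe_filter, Set.mem_ofPred_eq, Finset.mem_product, Finset.mem_sdiff,
      SimpleGraph.mem_neighborFinset]
    exact ⟨⟨hxy'.1, hy, hxy'.2.1⟩, hxy'.2.2⟩
  · rintro ⟨x, y⟩ _ ⟨x', y'⟩ _ hxy
    simp only [Prod.mk.injEq] at hxy
    exact Prod.ext (Subtype.ext hxy.1) (Subtype.ext hxy.2)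

open Classical in
/-- The edge expansion of a `b`-regular link on at least two vertices is at most `b`. -/
lemma LinksExpand.le_degree (h : LinksExpand G δ) (hG : IsABRegular G a b) (ha : 2 ≤ a) (v : V) :
    δ ≤ b := by
  obtain ⟨u, hu⟩ : (G.neighborFinset v).Nonempty := by
    rw [← Finset.card_pos, hG.card_neighborFinset]; omega
  have hS : ({u} : Finset V) ⊆ G.neighborFinset v := by simpa using hu
  have hle := h.le_card_edges v hS
  have hcard : #(G.neighborFinset v \ {u}) = a - 1 := by
    rw [Finset.card_sdiff_of_subset hS, hG.card_neighborFinset, Finset.card_singleton]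
  have hmin : min (#({u} : Finset V) : ℝ) (#(G.neighborFinset v \ {u}) : ℝ) = 1 := by
    rw [hcard, Finset.card_singleton, Nat.cast_one]
    exact min_eq_left (by exact_mod_cast (by omega : 1 ≤ a - 1))
  rw [hmin, mul_one] at hle
  refine hle.trans ?_
  rw [← hG.card_inter_neighborFinset ((G.mem_neighborFinset v u).1 hu), Nat.cast_le]
  refine Finset.card_le_card_of_injOn Prod.snd ?_ ?_
  · rintro ⟨x, y⟩ hxy
    simp only [Finset.coe_filter, Finset.mem_product, Finset.mem_singleton, Finset.mem_sdiff,
      Set.mem_ofPred_eq] at hxy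
    obtain ⟨⟨rfl, hy, _⟩, hadj⟩ := hxy
    simpa using ⟨(G.mem_neighborFinset v y).1 hy, hadj⟩
  · rintro ⟨x, y⟩ hxy ⟨x', y'⟩ hxy' hEq
    simp only [Finset.coe_filter, Finset.mem_product, Finset.mem_singleton, Finset.mem_sdiff,
      Set.mem_ofPred_eq] at hxy hxy'
    exact Prod.ext (hxy.1.1.trans hxy'.1.1.symm) hEq

open Classical in
/-- Links of degree at most one with more than `b + 1` vertices are disconnected. -/
lemma LinksExpand.isEmpty (h : LinksExpand G δ) (hG : IsABRegular G a b) (hδ : 0 < δ) (hb : b ≤ 1)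
    (ha : b + 2 ≤ a) : IsEmpty V := by
  refine ⟨fun v => ?_⟩
  obtain ⟨u, hu⟩ : (G.neighborFinset v).Nonempty := by
    rw [← Finset.card_pos, hG.card_neighborFinset]; omega
  have hvu := (G.mem_neighborFinset v u).1 hu
  set C := G.neighborFinset v ∩ G.neighborFinset u with hC
  have hCcard : #C = b := hG.card_inter_neighborFinset hvu
  -- As b ≤ 1, u and its neighbours in the link of v form a union of components of that link, with
  -- no edge leaving it.
  have hS : insert u C ⊆ G.neighborFinset v :=
    Finset.insert_subset hu Finset.inter_subset_left
  have huC : u ∉ C := by simp [hC]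
  have hScard : #(insert u C) = b + 1 := by rw [Finset.card_insert_of_notMem huC, hCcard]
  have hle := h.le_card_edges v hS
  have hempty : (({p ∈ insert u C ×ˢ (G.neighborFinset v \ insert u C) | G.Adj p.1 p.2} :
      Finset (V × V))) = ∅ := by
    refine Finset.filter_false_of_mem ?_
    rintro ⟨x, y⟩ hxy hadj
    rw [Finset.mem_product, Finset.mem_sdiff] at hxy
    obtain ⟨hx, hy, hyS⟩ := hxy
    simp only at hx hy hyS hadj
    rcases Finset.mem_insert.1 hx with rfl | hxC
    · exact hyS (Finset.mem_insert_of_mem (Finset.mem_inter.2 ⟨hy, by simpa using hadj⟩))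
    · have hxv := (G.mem_neighborFinset v x).1 (Finset.mem_inter.1 hxC).1
      have hxu := (G.mem_neighborFinset u x).1 (Finset.mem_inter.1 hxC).2
      have hone : #(G.neighborFinset v ∩ G.neighborFinset x) ≤ 1 := by
        rw [hG.card_inter_neighborFinset hxv]; exact hb
      have := Finset.card_le_one.1 hone u
        (Finset.mem_inter.2 ⟨hu, by simpa using hxu.symm⟩) y
        (Finset.mem_inter.2 ⟨hy, by simpa using hadj⟩)
      exact hyS (this ▸ Finset.mem_insert_self u C)
  rw [hempty, Finset.card_empty, Nat.cast_zero, Finset.card_sdiff_of_subset hS,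
    hG.card_neighborFinset, hScard] at hle
  have : 0 < min ((b + 1 : ℕ) : ℝ) ((a - (b + 1) : ℕ) : ℝ) :=
    lt_min (by positivity) (by exact_mod_cast (by omega : 0 < a - (b + 1)))
  nlinarith

end Links

/-! ### The test function -/

section TestFunction

variable {V : Type*} [Fintype V] {G : SimpleGraph V} {a b : ℕ} {δ : ℝ}

open Classical in
/-- The neighbours of `x` that are closer to `v` than `x`. -/
noncomputable def down (G : SimpleGraph V) (v x : V) : Finset V :=
  {y ∈ G.neighborFinset x | G.dist v y + 1 = G.dist v x}

lemma mem_down {v x y : V} : y ∈ down G v x ↔ G.Adj x y ∧ G.dist v y + 1 = G.dist v x := by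
  simp [down]

lemma dist_le_succ_of_adj {V : Type*} {G : SimpleGraph V} (v : V) {x y : V} (h : G.Adj x y) : G.dist v y ≤ G.dist v x + 1 := by
  rcases h.diff_dist_adj (u := v) with h | h | h <;> omega

lemma exists_mem_down {v x : V} (h : G.Reachable v x) (hx : 0 < G.dist v x) :
    ∃ y, y ∈ down G v x := by
  obtain ⟨p, hp⟩ := h.symm.exists_walk_length_eq_dist
  cases p with
  | nil => simp at hx
  | @cons _ y _ hadj q =>
    refine ⟨y, mem_down.2 ⟨hadj, ?_⟩⟩
    have h₁ := SimpleGraph.dist_le q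
    have h₂ := dist_le_succ_of_adj v hadj.symm
    rw [SimpleGraph.Walk.length_cons, SimpleGraph.dist_comm] at hp
    rw [SimpleGraph.dist_comm] at h₁
    omega

open Classical in
/-- The test function with profile `Y`: a vertex at distance `i` from the root `v` gets the value
`Y i`, plus a bonus proportional to its number of excess neighbours closer to the root. -/
noncomputable def testFun (G : SimpleGraph V) (v : V) (Y : ℕ → ℝ) (Λ : ℝ) (x : V) : ℝ :=
  if G.Reachable v x then
    Y (G.dist v x) + (Y (G.dist v x - 1) - Y (G.dist v x)) / Λ * ((#(down G v x) : ℝ) - 1)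
  else 0

variable {v : V} {Y : ℕ → ℝ} {Λ : ℝ}

/-- Truncated subtraction 0 - 1 = 0 removes the bonus at the root. -/
lemma testFun_root : testFun G v Y Λ v = Y 0 := by
  simp [testFun]

lemma le_testFun (hY : Antitone Y) (hΛ : 0 < Λ) {x : V} (hx : G.Reachable v x) :
    Y (G.dist v x) ≤ testFun G v Y Λ x := by
  rw [testFun, if_pos hx]
  rcases Nat.eq_zero_or_pos (G.dist v x) with h | h
  · simp [h]
  · obtain ⟨y, hy⟩ := exists_mem_down hx h
    have h1 : (1 : ℝ) ≤ #(down G v x) := by exact_mod_cast Finset.card_pos.2 ⟨y, hy⟩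
    have h2 : 0 ≤ (Y (G.dist v x - 1) - Y (G.dist v x)) / Λ :=
      div_nonneg (sub_nonneg.2 (hY (Nat.sub_le _ _))) hΛ.le
    have := mul_nonneg h2 (sub_nonneg.2 h1)
    linarith

lemma testFun_nonneg (hY : Antitone Y) (hY0 : ∀ i, 0 ≤ Y i) (hΛ : 0 < Λ) (x : V) :
    0 ≤ testFun G v Y Λ x := by
  by_cases hx : G.Reachable v x
  · exact (hY0 _).trans (le_testFun hY hΛ hx)
  · simp [testFun, hx]

/-- Distance R itself is allowed: the bonus there involves Y (R - 1). -/
lemma dist_le_of_testFun_ne_zero {R : ℕ} (hYR : ∀ i, R ≤ i → Y i = 0) {x : V}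
    (h : testFun G v Y Λ x ≠ 0) : G.Reachable v x ∧ G.dist v x ≤ R := by
  by_cases hx : G.Reachable v x
  · refine ⟨hx, ?_⟩
    by_contra! hlt
    refine h ?_
    rw [testFun, if_pos hx, hYR _ hlt.le, hYR _ (by omega)]
    simp
  · simp [testFun, hx] at h

open Classical in
/-- Expansion of the link of `x` gives the vertices further away from the root many excess
neighbours closer to the root. -/
lemma LinksExpand.le_sum_down (h : LinksExpand G δ) (x : V) :
    δ * min (#{y ∈ G.neighborFinset x | G.dist v y ≤ G.dist v x} : ℝ)
        (#{y ∈ G.neighborFinset x | ¬ G.dist v y ≤ G.dist v x} : ℝ)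
      ≤ ∑ u ∈ G.neighborFinset x with ¬ G.dist v u ≤ G.dist v x, ((#(down G v u) : ℝ) - 1) := by
  -- An edge of the link from y in S to u above x forces y to be level with x, so y is a lower
  -- neighbour of u other than x.
  have hle := h.le_card_edges x (S := {y ∈ G.neighborFinset x | G.dist v y ≤ G.dist v x})
    (Finset.filter_subset _ _)
  rw [← Finset.filter_not] at hle
  refine hle.trans ?_
  rw [Finset.card_filter, Finset.sum_product_right]
  push_cast
  refine Finset.sum_le_sum fun u hu => ?_
  rw [Finset.mem_filter, SimpleGraph.mem_neighborFinset] at hu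
  have hdu : G.dist v u = G.dist v x + 1 := by
    have := dist_le_succ_of_adj v hu.1
    omega
  have hxu : x ∈ down G v u := mem_down.2 ⟨hu.1.symm, hdu.symm⟩
  rw [← Nat.cast_one, ← Nat.cast_sub (Finset.card_pos.2 ⟨x, hxu⟩), ← Finset.card_erase_of_mem hxu]
  have hsum : (∑ y ∈ G.neighborFinset x with G.dist v y ≤ G.dist v x,
      if G.Adj y u then ((1 : ℕ) : ℝ) else 0)
      = #{y ∈ {y ∈ G.neighborFinset x | G.dist v y ≤ G.dist v x} | G.Adj y u} := by
    rw [Finset.card_filter]; push_cast; rfl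
  push_cast at hsum ⊢
  rw [hsum, Nat.cast_le]
  refine Finset.card_le_card fun y hy => ?_
  rw [Finset.mem_filter, Finset.mem_filter, SimpleGraph.mem_neighborFinset] at hy
  obtain ⟨⟨hxy, hyd⟩, hyu⟩ := hy
  refine Finset.mem_erase.2 ⟨hxy.ne', mem_down.2 ⟨hyu.symm, ?_⟩⟩
  have := dist_le_succ_of_adj v hyu
  omega

open Classical in
/-- The adjacency matrix expands the test function by at least the factor `l`. -/
lemma mul_testFun_le (hG : IsABRegular G a b) (hexp : LinksExpand G δ) (hδ : 0 ≤ δ)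
    {r l : ℝ} (hr : r ≤ δ * min ((b : ℝ) + 1) ((a : ℝ) - b - 1)) (hδΛ : δ ≤ Λ) (hΛ : 0 < Λ)
    (hlΛ : l ≤ Λ) (hla : l ≤ a) (hY : Antitone Y) (hY0 : ∀ i, 0 ≤ Y i) (hY1 : Y 0 = Y 1)
    (hrec : ∀ i, l * Y (i + 1) ≤ Y i + (b + r / Λ) * Y (i + 1)
      + ((a : ℝ) - b - 1 - r / Λ) * Y (i + 2)) (x : V) :
    l * testFun G v Y Λ x ≤ ∑ y ∈ G.neighborFinset x, testFun G v Y Λ y := by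
  by_cases hx : G.Reachable v x
  swap
  · rw [testFun, if_neg hx, mul_zero]
    exact Finset.sum_nonneg fun y _ => testFun_nonneg hY hY0 hΛ y
  have hreach : ∀ y ∈ G.neighborFinset x, G.Reachable v y := fun y hy =>
    hx.trans ((G.mem_neighborFinset x y).1 hy).reachable
  obtain hd | ⟨i, hi⟩ : G.dist v x = 0 ∨ ∃ i, G.dist v x = i + 1 := by
    rcases Nat.eq_zero_or_pos (G.dist v x) with h | h
    · exact Or.inl h
    · exact Or.inr ⟨G.dist v x - 1, by omega⟩
  -- The root has no lower neighbour; Y 0 = Y 1 and l ≤ a handle it.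
  · obtain rfl : v = x := hx.dist_eq_zero_iff.1 hd
    rw [testFun_root]
    have : ∑ y ∈ G.neighborFinset v, Y 1 ≤ ∑ y ∈ G.neighborFinset v, testFun G v Y Λ y := by
      refine Finset.sum_le_sum fun y hy => ?_
      have h1 := le_testFun (Λ := Λ) hY hΛ (hreach y hy)
      rwa [SimpleGraph.dist_eq_one_iff_adj.2 ((G.mem_neighborFinset v y).1 hy)] at h1
    refine le_trans ?_ this
    rw [Finset.sum_const, hG.card_neighborFinset, nsmul_eq_mul, hY1]
    exact mul_le_mul_of_nonneg_right hla (hY0 1)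
  set C := {y ∈ G.neighborFinset x | G.dist v y ≤ G.dist v x} with hC
  set U := {y ∈ G.neighborFinset x | ¬ G.dist v y ≤ G.dist v x} with hU
  have hT := hexp.le_sum_down (v := v) x
  rw [← hC, ← hU] at hT
  set T := ∑ u ∈ U, ((#(down G v u) : ℝ) - 1) with hTdef
  have hCU : (#C : ℝ) + #U = a := by
    rw [← hG.card_neighborFinset x]
    exact_mod_cast Finset.card_filter_add_card_filter_not (s := G.neighborFinset x)
      (fun y => G.dist v y ≤ G.dist v x)
  have hDC : down G v x ⊆ C := by
    intro y hy
    obtain ⟨h1, h2⟩ := mem_down.1 hy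
    exact Finset.mem_filter.2 ⟨by simpa using h1, by omega⟩
  obtain ⟨z, hz⟩ := exists_mem_down hx (by omega)
  have hp : (1 : ℝ) ≤ #(down G v x) := by exact_mod_cast Finset.card_pos.2 ⟨z, hz⟩
  -- Common neighbours of x and its lower neighbour z are at most one step beyond z, hence not above
  -- x.
  have hCb : (b : ℝ) + 1 ≤ #C := by
    have hzx := mem_down.1 hz
    have hsub : insert z (G.neighborFinset x ∩ G.neighborFinset z) ⊆ C := by
      refine Finset.insert_subset (hDC hz) fun y hy => ?_
      rw [Finset.mem_inter, SimpleGraph.mem_neighborFinset, SimpleGraph.mem_neighborFinset] at hy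
      refine Finset.mem_filter.2 ⟨by simpa using hy.1, ?_⟩
      have := dist_le_succ_of_adj v hy.2
      omega
    have hcard := Finset.card_le_card hsub
    rw [Finset.card_insert_of_notMem (by simp), hG.card_inter_neighborFinset hzx.1] at hcard
    exact_mod_cast hcard
  have hsumC : (#(down G v x) : ℝ) * Y i + ((#C : ℝ) - #(down G v x)) * Y (i + 1)
      ≤ ∑ y ∈ C, testFun G v Y Λ y := by
    rw [← Finset.sum_sdiff hDC, add_comm]
    refine add_le_add ?_ ?_
    · rw [← Nat.cast_sub (Finset.card_le_card hDC), ← Finset.card_sdiff_of_subset hDC,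
        ← nsmul_eq_mul]
      refine Finset.card_nsmul_le_sum _ _ _ fun y hy => ?_
      have hyC := Finset.mem_filter.1 (Finset.mem_sdiff.1 hy).1
      refine le_trans (hY ?_) (le_testFun hY hΛ (hreach y hyC.1))
      exact hi ▸ hyC.2
    · rw [← nsmul_eq_mul]
      refine Finset.card_nsmul_le_sum _ _ _ fun y hy => ?_
      have hyC := Finset.mem_filter.1 (hDC hy)
      refine le_trans (hY ?_) (le_testFun hY hΛ (hreach y hyC.1))
      have := (mem_down.1 hy).2
      omega
  have hsumU : ∑ y ∈ U, testFun G v Y Λ y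
      = #U * Y (i + 2) + (Y (i + 1) - Y (i + 2)) / Λ * T := by
    rw [hTdef, Finset.mul_sum, ← nsmul_eq_mul, ← Finset.sum_const, ← Finset.sum_add_distrib]
    refine Finset.sum_congr rfl fun y hy => ?_
    have hyU := Finset.mem_filter.1 hy
    have hdy : G.dist v y = i + 2 := by
      have := dist_le_succ_of_adj v ((G.mem_neighborFinset x y).1 hyU.1)
      omega
    rw [testFun, if_pos (hreach y hyU.1), hdy]
    rfl
  rw [← Finset.sum_filter_add_sum_filter_not (G.neighborFinset x)
    (fun y => G.dist v y ≤ G.dist v x), ← hC, ← hU, hsumU, testFun, if_pos hx, hi,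
    Nat.add_sub_cancel]
  have hY₁ : 0 ≤ Y i - Y (i + 1) := sub_nonneg.2 (hY (Nat.le_succ _))
  have hY₂ : 0 ≤ Y (i + 1) - Y (i + 2) := sub_nonneg.2 (hY (Nat.le_succ _))
  have hrC := hrec i
  set p := ((#(down G v x) : ℕ) : ℝ)
  set m := ((#C : ℕ) : ℝ)
  set s := ((#U : ℕ) : ℝ)
  set y₀ := Y i
  set y₁ := Y (i + 1)
  set y₂ := Y (i + 2)
  have he : 0 ≤ m - (b + 1) := by linarith
  have hmin : min ((b : ℝ) + 1) ((a : ℝ) - b - 1) - (m - (b + 1)) ≤ min m s := by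
    refine le_min ?_ ?_
    · linarith [min_le_left ((b : ℝ) + 1) ((a : ℝ) - b - 1)]
    · linarith [min_le_right ((b : ℝ) + 1) ((a : ℝ) - b - 1)]
  -- Each vertex of C beyond b + 1 lowers the expansion bound by at most δ ≤ Λ, hence the bonus term
  -- by at most y₁ - y₂, which is what its own larger value returns.
  have hrT : r - Λ * (m - (b + 1)) ≤ T := by
    have h1 := mul_le_mul_of_nonneg_left hmin hδ
    have h2 := mul_le_mul_of_nonneg_right hδΛ he
    rw [mul_sub] at h1
    linarith
  have hw : (y₁ - y₂) / Λ * (r - Λ * (m - (b + 1))) ≤ (y₁ - y₂) / Λ * T :=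
    mul_le_mul_of_nonneg_left hrT (div_nonneg hY₂ hΛ.le)
  have hw' : (y₁ - y₂) / Λ * (r - Λ * (m - (b + 1)))
      = r / Λ * (y₁ - y₂) - (y₁ - y₂) * (m - (b + 1)) := by field_simp
  have hlp : l * ((y₀ - y₁) / Λ * (p - 1)) ≤ (y₀ - y₁) * (p - 1) := by
    have h1 : (y₀ - y₁) * (p - 1) = Λ * ((y₀ - y₁) / Λ * (p - 1)) := by field_simp
    rw [h1]
    exact mul_le_mul_of_nonneg_right hlΛ
      (mul_nonneg (div_nonneg hY₁ hΛ.le) (by linarith))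
  have hs : s = a - m := by linarith
  rw [hs]
  nlinarith

open Classical in
lemma card_ball_le (hG : G.IsRegularOfDegree a) (v : V) (k : ℕ) :
    #{x : V | G.Reachable v x ∧ G.dist v x ≤ k} ≤ (a + 1) ^ k := by
  induction k with
  | zero =>
    rw [pow_zero, Finset.card_le_one]
    intro x hx y hy
    simp only [Finset.mem_filter, Finset.mem_univ, true_and, Nat.le_zero] at hx hy
    rw [← hx.1.dist_eq_zero_iff.1 hx.2, ← hy.1.dist_eq_zero_iff.1 hy.2]
  | succ k ih =>
    have hsub : ({x : V | G.Reachable v x ∧ G.dist v x ≤ k + 1} : Finset V) ⊆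
        ({x : V | G.Reachable v x ∧ G.dist v x ≤ k} : Finset V).biUnion
          fun y => insert y (G.neighborFinset y) := by
      intro x hx
      simp only [Finset.mem_filter, Finset.mem_univ, true_and, Finset.mem_biUnion,
        Finset.mem_insert, SimpleGraph.mem_neighborFinset] at hx ⊢
      by_cases h : G.dist v x ≤ k
      · exact ⟨x, ⟨hx.1, h⟩, Or.inl rfl⟩
      · obtain ⟨y, hy⟩ := exists_mem_down hx.1 (by omega)
        obtain ⟨h1, h2⟩ := mem_down.1 hy
        exact ⟨y, ⟨hx.1.trans h1.reachable, by omega⟩, Or.inr h1.symm⟩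
    refine (Finset.card_le_card hsub).trans ?_
    refine (Finset.card_biUnion_le_card_mul _ _ (a + 1) fun y _ => ?_).trans ?_
    · exact (Finset.card_insert_le _ _).trans (Nat.succ_le_succ (hG y).le)
    · rw [pow_succ]
      exact Nat.mul_le_mul_right _ ih

end TestFunction

/-! ### The generic range -/

lemma one_lt_cParam {a b : ℕ} (ha : b + 3 ≤ a) : 1 < cParam a b := by
  have : (b : ℝ) + 3 ≤ a := by exact_mod_cast ha
  rw [cParam, Real.lt_sqrt zero_le_one]
  linarith

lemma cParam_sq {a b : ℕ} (ha : b + 1 ≤ a) : cParam a b ^ 2 = (a : ℝ) - b - 1 := by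
  have : (b : ℝ) + 1 ≤ a := by exact_mod_cast ha
  rw [cParam, Real.sq_sqrt (by linarith)]

lemma cap_pos {b c : ℝ} (hb : 0 < b) (hc : 1 < c) : 0 < b * (c ^ 3 - c ^ 2) / (b + c) := by
  have : 0 < c ^ 3 - c ^ 2 := by
    have : 0 < c ^ 2 * (c - 1) := mul_pos (by positivity) (by linarith)
    nlinarith
  have : 0 < b + c := by linarith
  positivity

lemma minDegree_pos {a b : ℕ} (ha : b + 2 ≤ a) : 0 < min ((b : ℝ) + 1) ((a : ℝ) - b - 1) := by
  have : (b : ℝ) + 2 ≤ a := by exact_mod_cast ha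
  exact lt_min (by positivity) (by linarith)

lemma rParam_mem {a b : ℕ} (hb : 0 < b) (ha : b + 3 ≤ a) {δ : ℝ} (hδ : 0 < δ) :
    0 < rParam a b δ ∧ rParam a b δ ≤
      b * (cParam a b ^ 3 - cParam a b ^ 2) / (b + cParam a b) :=
  ⟨lt_min (mul_pos hδ (minDegree_pos (by omega)))
    (cap_pos (by exact_mod_cast hb) (one_lt_cParam ha)), min_le_right _ _⟩

lemma gain_pos {a b : ℕ} (hb : 0 < b) (ha : b + 3 ≤ a) {δ : ℝ} (hδ : 0 < δ) :
    0 < gain a b δ := by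
  have hr := rParam_mem hb ha hδ
  rw [gain_eq_gainFun, ← gainFun_zero b (cParam a b)]
  exact gainFun_strictMonoOn (by exact_mod_cast hb) (one_lt_cParam ha)
    ⟨le_rfl, hr.1.le.trans hr.2⟩ ⟨hr.1.le, hr.2⟩ hr.1

lemma gain_lt_gain {a b : ℕ} (hb : 0 < b) (ha : b + 3 ≤ a) {δ₁ δ₂ : ℝ} (hδ₁ : 0 < δ₁)
    (h : δ₁ < δ₂) (hcap : δ₂ * min ((b : ℝ) + 1) ((a : ℝ) - b - 1)
      ≤ b * (cParam a b ^ 3 - cParam a b ^ 2) / (b + cParam a b)) :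
    gain a b δ₁ < gain a b δ₂ := by
  have hm := minDegree_pos (a := a) (b := b) (by omega)
  have h₁ := rParam_mem hb ha hδ₁
  have h₂ := rParam_mem hb ha (hδ₁.trans h)
  rw [gain_eq_gainFun, gain_eq_gainFun]
  refine gainFun_strictMonoOn (by exact_mod_cast hb) (one_lt_cParam ha) ⟨h₁.1.le, h₁.2⟩
    ⟨h₂.1.le, h₂.2⟩ ?_
  have hlt := mul_lt_mul_of_pos_right h hm
  calc rParam a b δ₁ ≤ δ₁ * min ((b : ℝ) + 1) ((a : ℝ) - b - 1) := min_le_left _ _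
    _ < δ₂ * min ((b : ℝ) + 1) ((a : ℝ) - b - 1) := hlt
    _ = rParam a b δ₂ := (min_eq_left hcap).symm

/-- For large `a` the cap in `rParam` is not attained in the range of possible expansions. -/
lemma mul_min_le_cap {a b : ℕ} (ha : b ^ 2 + 5 * b + 5 ≤ a) {δ : ℝ} (hδb : δ ≤ b) :
    δ * min ((b : ℝ) + 1) ((a : ℝ) - b - 1)
      ≤ b * (cParam a b ^ 3 - cParam a b ^ 2) / (b + cParam a b) := by
  have hc2 := cParam_sq (a := a) (b := b) (by nlinarith)
  have ha' : (b : ℝ) ^ 2 + 5 * b + 5 ≤ a := by exact_mod_cast ha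
  have hb0 : (0 : ℝ) ≤ b := Nat.cast_nonneg b
  -- The hypothesis on a says a - b - 1 ≥ (b + 2)².
  have hcb : (b : ℝ) + 2 ≤ cParam a b := by
    rw [cParam]
    refine Real.le_sqrt_of_sq_le ?_
    nlinarith
  set c := cParam a b
  rw [le_div_iff₀ (by linarith)]
  have h1 : δ * min ((b : ℝ) + 1) ((a : ℝ) - b - 1) ≤ b * (b + 1) :=
    mul_le_mul hδb (min_le_left _ _) (le_min (by linarith) (by nlinarith)) hb0
  have h2 : ((b : ℝ) + 1) * (b + c) ≤ c ^ 3 - c ^ 2 := by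
    have : (b : ℝ) + c ≤ c ^ 2 := by nlinarith
    nlinarith [mul_le_mul (by linarith : (b : ℝ) + 1 ≤ c - 1) this (by linarith) (by linarith)]
  calc δ * min ((b : ℝ) + 1) ((a : ℝ) - b - 1) * (b + c) ≤ b * (b + 1) * (b + c) :=
        mul_le_mul_of_nonneg_right h1 (by linarith)
    _ = b * ((b + 1) * (b + c)) := by ring
    _ ≤ b * (c ^ 3 - c ^ 2) := mul_le_mul_of_nonneg_left h2 hb0

open Classical in
/-- A large regular graph has two vertices at large distance from each other. -/
lemma exists_far {V : Type*} [Fintype V] {G : SimpleGraph V} {a : ℕ}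
    (hG : G.IsRegularOfDegree a) {k : ℕ} (hn : (a + 1) ^ k < Fintype.card V) (v : V) :
    ∃ w, ¬ (G.Reachable v w ∧ G.dist v w ≤ k) := by
  by_contra! h
  have := card_ball_le hG v k
  rw [Finset.filter_true_of_mem fun x _ => h x, Finset.card_univ] at this
  omega

lemma eventually_le_secondEigenvalue {a b : ℕ} (hb : 2 ≤ b) (ha : b + 3 ≤ a) {δ : ℝ} (hδ : 0 < δ)
    {η : ℝ} (hη : 0 < η) :
    ∃ N : ℕ, ∀ (V : Type*) [Fintype V] (G : SimpleGraph V), N ≤ Fintype.card V →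
      IsABRegular G a b → LinksExpand G δ →
      (b + 2 * cParam a b) * Real.exp (gain a b δ) - η ≤ secondEigenvalue G := by
  have hb0 : 0 < b := by omega
  have hbR : (0 : ℝ) < b := by exact_mod_cast hb0
  have hr := rParam_mem hb0 ha hδ
  have hc := one_lt_cParam ha
  have hc2 := cParam_sq (a := a) (b := b) (by omega)
  rw [gain_eq_gainFun]
  set Λ := (b + 2 * cParam a b) * Real.exp (gainFun b (cParam a b) (rParam a b δ)) with hΛdef
  obtain ⟨hLΛ, hs, hΛ⟩ := le_add_two_sqrt hbR hc hr.1.le hr.2 hΛdef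
  have hΛ0 : 0 < Λ := by linarith
  set s := rParam a b δ / Λ with hsdef
  set k := √(cParam a b ^ 2 - s) with hk
  have hk0 : 0 < k := Real.sqrt_pos.2 (by linarith)
  have hk2 : k ^ 2 = cParam a b ^ 2 - s := Real.sq_sqrt (by linarith)
  obtain ⟨R, hR2, hR⟩ : ∃ R : ℕ, 2 ≤ R ∧ 2 * k * (1 - Real.cos (Real.pi / R)) < η := by
    have h1 : Filter.Tendsto (fun R : ℕ => Real.pi / (R : ℝ)) Filter.atTop (nhds 0) :=
      tendsto_const_div_atTop_nhds_zero_nat Real.pi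
    have h2 := (((Real.continuous_cos.tendsto 0).comp h1).const_sub 1).const_mul (2 * k)
    rw [Real.cos_zero, sub_self, mul_zero] at h2
    obtain ⟨R, h3, h4⟩ := ((h2.eventually_lt_const hη).and (Filter.eventually_ge_atTop 2)).exists
    exact ⟨R, h4, h3⟩
  have hcos := Real.cos_le_one (Real.pi / R)
  set l := Λ - 2 * k * (1 - Real.cos (Real.pi / R)) with hl
  have hlΛ : l ≤ Λ := by
    have := mul_nonneg (mul_nonneg two_pos.le hk0.le) (sub_nonneg.2 hcos)
    linarith
  -- The right side equals a, so this also gives the bound l ≤ a needed at the root.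
  have hl' : l ≤ 1 + (b + s) + k ^ 2 := by nlinarith [sq_nonneg (k - 1)]
  obtain ⟨Y, hY, hYR, hY00, hY01, hrec⟩ := exists_profile (B := b + s) (k := k) (l := l) R hR2 hk0
    (by rw [hl]; nlinarith) hl'
  have hY0 : ∀ i, 0 ≤ Y i := fun i =>
    (hYR (max i R) (le_max_right _ _)).ge.trans (hY (le_max_left _ _))
  -- Two supports of radius R, plus one possible edge between them.
  refine ⟨(a + 1) ^ (2 * R + 1) + 1, fun V _ G hn hG hexp => ?_⟩
  obtain ⟨v₁⟩ : Nonempty V := Fintype.card_pos_iff.1 (by omega)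
  obtain ⟨v₂, hfar⟩ := exists_far hG.1 (k := 2 * R + 1) (by omega) v₁
  have hδb := hexp.le_degree hG (by omega) v₁
  have hstep : ∀ v x, l * testFun G v Y Λ x ≤ _ := fun v x =>
    mul_testFun_le (v := v) hG hexp hδ.le (r := rParam a b δ) (min_le_left _ _)
      (by linarith) hΛ0 hlΛ (by linarith) hY hY0 hY01
      (by rw [← hsdef, ← hc2, ← hk2]; exact hrec) x
  have hclose : ∀ x y, (x = y ∨ G.Adj x y) → testFun G v₁ Y Λ x * testFun G v₂ Y Λ y = 0 := by
    intro x y hxy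
    by_contra hne
    obtain ⟨hr₁, hd₁⟩ := dist_le_of_testFun_ne_zero hYR (left_ne_zero_of_mul hne)
    obtain ⟨hr₂, hd₂⟩ := dist_le_of_testFun_ne_zero hYR (right_ne_zero_of_mul hne)
    obtain ⟨hr₃, hd₃⟩ : G.Reachable v₁ y ∧ G.dist v₁ y ≤ R + 1 := by
      rcases hxy with rfl | hxy
      · exact ⟨hr₁, by omega⟩
      · have := dist_le_succ_of_adj v₁ hxy
        exact ⟨hr₁.trans hxy.reachable, by omega⟩
    refine hfar ⟨hr₃.trans hr₂.symm, ?_⟩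
    have := hr₃.dist_triangle_left v₂
    rw [SimpleGraph.dist_comm (u := y)] at this
    omega
  have := le_secondEigenvalue G (l := l) (v₁ := v₁) (v₂ := v₂)
    (testFun_nonneg hY hY0 hΛ0) (testFun_nonneg hY hY0 hΛ0)
    (by rwa [testFun_root]) (by rwa [testFun_root]) (hstep v₁) (hstep v₂)
    (fun x => hclose x x (Or.inl rfl)) (fun x y h => hclose x y (Or.inr h))
  linarith

/-! ### The degenerate ranges -/

section Degenerate

variable {V : Type*} [Fintype V] {G : SimpleGraph V} {b : ℕ}

open Classical in
/-- If the links are complete graphs, the graph is a disjoint union of complete graphs. -/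
lemma le_secondEigenvalue_of_complete_links (hG : IsABRegular G (b + 1) b)
    (hn : b + 2 < Fintype.card V) : (b : ℝ) + 1 ≤ secondEigenvalue G := by
  have hclosed : ∀ v x y, x ∈ insert v (G.neighborFinset v) → G.Adj x y →
      y ∈ insert v (G.neighborFinset v) := by
    intro v x y hx hxy
    rcases Finset.mem_insert.1 hx with rfl | hx
    · exact Finset.mem_insert_of_mem (by simpa using hxy)
    · have hvx := (G.mem_neighborFinset v x).1 hx
      have hsub : insert v (G.neighborFinset v ∩ G.neighborFinset x) ⊆ G.neighborFinset x :=
        Finset.insert_subset (by simpa using hvx.symm) Finset.inter_subset_right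
      have heq := Finset.eq_of_subset_of_card_le hsub (by
        rw [Finset.card_insert_of_notMem (by simp), hG.card_inter_neighborFinset hvx,
          hG.card_neighborFinset])
      have hy : y ∈ G.neighborFinset x := by simpa using hxy
      rw [← heq] at hy
      exact Finset.insert_subset_insert v Finset.inter_subset_left hy
  have hstep : ∀ v x, ((b : ℝ) + 1) * (if x ∈ insert v (G.neighborFinset v) then (1 : ℝ) else 0)
      ≤ ∑ y ∈ G.neighborFinset x, if y ∈ insert v (G.neighborFinset v) then (1 : ℝ) else 0 := by
    intro v x
    split_ifs with hx
    · rw [Finset.sum_congr rfl fun y hy =>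
        if_pos (hclosed v x y hx ((G.mem_neighborFinset x y).1 hy)), Finset.sum_const,
        hG.card_neighborFinset]
      simp
    · rw [mul_zero]
      exact Finset.sum_nonneg fun y _ => by split_ifs <;> norm_num
  obtain ⟨v₁⟩ : Nonempty V := Fintype.card_pos_iff.1 (by omega)
  obtain ⟨v₂, hv₂⟩ : ∃ w, w ∉ insert v₁ (G.neighborFinset v₁) := by
    by_contra! h
    have h1 := Finset.card_insert_le v₁ (G.neighborFinset v₁)
    rw [Finset.eq_univ_of_forall h, Finset.card_univ, hG.card_neighborFinset] at h1
    omega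
  have hclose : ∀ x, x ∈ insert v₁ (G.neighborFinset v₁) →
      x ∉ insert v₂ (G.neighborFinset v₂) := by
    intro x h₁ h₂
    refine hv₂ ?_
    rcases Finset.mem_insert.1 h₂ with rfl | h₂
    · exact h₁
    · exact hclosed v₁ x v₂ h₁ ((G.mem_neighborFinset v₂ x).1 h₂).symm
  refine le_secondEigenvalue G (v₁ := v₁) (v₂ := v₂) (fun x => by split_ifs <;> norm_num)
    (fun x => by split_ifs <;> norm_num) (by simp) (by simp) (hstep v₁) (hstep v₂)
    (fun x => ?_) (fun x y hxy => ?_)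
  · by_cases h₁ : x ∈ insert v₁ (G.neighborFinset v₁)
    · rw [if_neg (hclose x h₁), mul_zero]
    · rw [if_neg h₁, zero_mul]
  · by_cases h₁ : x ∈ insert v₁ (G.neighborFinset v₁)
    · rw [if_neg (hclose y (hclosed v₁ x y h₁ hxy)), mul_zero]
    · rw [if_neg h₁, zero_mul]

open Classical in
/-- If all links are complements of perfect matchings, vertices at distance two have the same
neighbours. -/
lemma neighborFinset_eq_of_common_neighbor (hG : IsABRegular G (b + 2) b) (hb : 1 ≤ b)
    {v x y : V} (hvy : G.Adj v y) (hyx : G.Adj y x) (hxv : x ≠ v) (hnadj : ¬ G.Adj v x) :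
    G.neighborFinset x = G.neighborFinset v := by
  -- In the link of z every vertex has a single non-neighbour; v and x are each other's.
  have hcommon : ∀ z, G.Adj v z → G.Adj z x → ∀ w, G.Adj z w → w ≠ v → w ≠ x →
      G.Adj v w ∧ G.Adj x w := by
    intro z hvz hzx w hzw hwv hwx
    have hcard : #((G.neighborFinset z \ {v, x})) = b := by
      rw [Finset.card_sdiff_of_subset, hG.card_neighborFinset, Finset.card_pair hxv.symm]
      · omega
      · intro u hu
        rcases Finset.mem_insert.1 hu with rfl | hu
        · simpa using hvz.symm
        · rw [Finset.mem_singleton.1 hu]; simpa using hzx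
    have hw : w ∈ G.neighborFinset z \ {v, x} := by simp [hzw, hwv, hwx]
    have h₁ : G.neighborFinset z ∩ G.neighborFinset v = G.neighborFinset z \ {v, x} := by
      refine Finset.eq_of_subset_of_card_le (fun u hu => ?_) ?_
      · simp only [Finset.mem_inter, SimpleGraph.mem_neighborFinset] at hu
        simp only [Finset.mem_sdiff, SimpleGraph.mem_neighborFinset, Finset.mem_insert,
          Finset.mem_singleton, not_or]
        exact ⟨hu.1, hu.2.ne', fun h => hnadj (h ▸ hu.2)⟩
      · rw [hcard, hG.card_inter_neighborFinset hvz.symm]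
    have h₂ : G.neighborFinset z ∩ G.neighborFinset x = G.neighborFinset z \ {v, x} := by
      refine Finset.eq_of_subset_of_card_le (fun u hu => ?_) ?_
      · simp only [Finset.mem_inter, SimpleGraph.mem_neighborFinset] at hu
        simp only [Finset.mem_sdiff, SimpleGraph.mem_neighborFinset, Finset.mem_insert,
          Finset.mem_singleton, not_or]
        exact ⟨hu.1, fun h => hnadj (h ▸ hu.2.symm), hu.2.ne'⟩
      · rw [hcard, hG.card_inter_neighborFinset hzx]
    have hw₁ := hw
    rw [← h₁] at hw₁
    rw [← h₂] at hw
    simp only [Finset.mem_inter, SimpleGraph.mem_neighborFinset] at hw hw₁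
    exact ⟨hw₁.2, hw.2⟩
  refine (Finset.eq_of_subset_of_card_le (fun h hh => ?_) ?_).symm
  swap
  · rw [hG.card_neighborFinset, hG.card_neighborFinset]
  rw [SimpleGraph.mem_neighborFinset] at hh ⊢
  have hhx : h ≠ x := fun he => hnadj (he ▸ hh)
  by_cases hhy : h = y
  · rw [hhy]; exact hyx.symm
  by_cases hadj : G.Adj y h
  · exact (hcommon y hvy hyx h hadj hh.ne' hhx).2
  -- Now h and y are antipodal in the link of v. A common neighbour z of v and y is adjacent to x by
  -- the link of y and to h by that of v; the link of z then gives the edge between x and h.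
  obtain ⟨z, hz⟩ : (G.neighborFinset v ∩ G.neighborFinset y).Nonempty := by
    rw [← Finset.card_pos, hG.card_inter_neighborFinset hvy]; omega
  simp only [Finset.mem_inter, SimpleGraph.mem_neighborFinset] at hz
  have hzx : z ≠ x := fun he => hnadj (he ▸ hz.1)
  have hxz := (hcommon y hvy hyx z hz.2 hz.1.ne' hzx).2
  have hsub : G.neighborFinset v ∩ G.neighborFinset h ⊆ G.neighborFinset v \ {h, y} := by
    intro u hu
    simp only [Finset.mem_inter, SimpleGraph.mem_neighborFinset] at hu
    simp only [Finset.mem_sdiff, SimpleGraph.mem_neighborFinset, Finset.mem_insert,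
      Finset.mem_singleton, not_or]
    exact ⟨hu.1, hu.2.ne', fun he => hadj (he ▸ hu.2.symm)⟩
  have heq := Finset.eq_of_subset_of_card_le hsub (by
    rw [hG.card_inter_neighborFinset hh, Finset.card_sdiff_of_subset, hG.card_neighborFinset,
      Finset.card_pair hhy]
    · omega
    · intro u hu
      rcases Finset.mem_insert.1 hu with rfl | hu
      · simpa using hh
      · rw [Finset.mem_singleton.1 hu]; simpa using hvy)
  have hzmem : z ∈ G.neighborFinset v \ {h, y} := by
    simp only [Finset.mem_sdiff, SimpleGraph.mem_neighborFinset, Finset.mem_insert,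
      Finset.mem_singleton, not_or]
    exact ⟨hz.1, fun he => hadj (he ▸ hz.2), hz.2.ne'⟩
  rw [← heq] at hzmem
  simp only [Finset.mem_inter, SimpleGraph.mem_neighborFinset] at hzmem
  exact (hcommon z hz.1 hxz.symm h hzmem.2.symm hh.ne' hhx).2

open Classical in
/-- A connected graph all of whose links are complements of perfect matchings is small. -/
lemma card_le_of_cocktailParty_links (hG : IsABRegular G (b + 2) b) (hb : 1 ≤ b)
    (hconn : G.Connected) : Fintype.card V ≤ 2 * b + 5 := by
  obtain ⟨v⟩ := hconn.nonempty
  have hclosed : ∀ x, x = v ∨ G.Adj v x ∨ G.neighborFinset x = G.neighborFinset v := by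
    intro x
    obtain ⟨p⟩ := hconn.preconnected x v
    induction p with
    | nil => exact Or.inl rfl
    | @cons x y v hadj q ih =>
      rcases ih with rfl | h | h
      · exact Or.inr (Or.inl hadj.symm)
      · by_cases hxv : x = v
        · exact Or.inl hxv
        by_cases hvx : G.Adj v x
        · exact Or.inr (Or.inl hvx)
        exact Or.inr (Or.inr
          (neighborFinset_eq_of_common_neighbor hG hb h hadj.symm hxv hvx))
      · have : x ∈ G.neighborFinset y := by simpa using hadj.symm
        rw [h] at this
        exact Or.inr (Or.inl (by simpa using this))
  obtain ⟨y, hy⟩ : (G.neighborFinset v).Nonempty := by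
    rw [← Finset.card_pos, hG.card_neighborFinset]; omega
  -- Twins of v are adjacent to y, whence the bound 1 + 2(b + 2).
  have huniv : (Finset.univ : Finset V) ⊆ insert v (G.neighborFinset v ∪ G.neighborFinset y) := by
    intro x _
    simp only [Finset.mem_insert, Finset.mem_union, SimpleGraph.mem_neighborFinset]
    rcases hclosed x with h | h | h
    · exact Or.inl h
    · exact Or.inr (Or.inl h)
    · refine Or.inr (Or.inr ?_)
      rw [← h] at hy
      exact ((G.mem_neighborFinset x y).1 hy).symm
  have h₁ := Finset.card_le_card huniv
  have h₂ := Finset.card_insert_le v (G.neighborFinset v ∪ G.neighborFinset y)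
  have h₃ := Finset.card_union_le (G.neighborFinset v) (G.neighborFinset y)
  rw [hG.card_neighborFinset, hG.card_neighborFinset] at h₃
  rw [Finset.card_univ] at h₁
  omega

end Degenerate

/-! ### Assembling the function `ε` -/

/-- An upward closed family of bounds, each of which holds eventually, holds with an error term
that tends to zero. -/
lemma exists_tendsto_zero_of_eventually {p : ℕ → ℝ → Prop}
    (hmono : ∀ n η η', η ≤ η' → p n η → p n η') (hbdd : ∀ n, ∃ η, 0 ≤ η ∧ p n η)
    (hev : ∀ η, 0 < η → ∃ N, ∀ n, N ≤ n → p n η) :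
    ∃ o : ℕ → ℝ, Filter.Tendsto o Filter.atTop (nhds 0) ∧ ∀ n, p n (o n) := by
  have hbelow : ∀ n, BddBelow {η | 0 ≤ η ∧ p n η} := fun n => ⟨0, fun η hη => hη.1⟩
  -- The added 1 / (n + 1) avoids having to show that the infimum is attained.
  refine ⟨fun n => sInf {η | 0 ≤ η ∧ p n η} + 1 / ((n : ℝ) + 1), ?_, fun n => ?_⟩
  · suffices h : Filter.Tendsto (fun n => sInf {η | 0 ≤ η ∧ p n η}) Filter.atTop (nhds 0) by
      simpa using h.add tendsto_one_div_add_atTop_nhds_zero_nat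
    rw [Metric.tendsto_atTop]
    intro η hη
    obtain ⟨N, hN⟩ := hev (η / 2) (by linarith)
    refine ⟨N, fun n hn => ?_⟩
    have h₁ : sInf {η | 0 ≤ η ∧ p n η} ≤ η / 2 :=
      csInf_le (hbelow n) ⟨by linarith, hN n hn⟩
    have h₀ : 0 ≤ sInf {η | 0 ≤ η ∧ p n η} := Real.sInf_nonneg fun η hη => hη.1
    rw [Real.dist_eq, sub_zero, abs_of_nonneg h₀]
    linarith
  · obtain ⟨η, hη, hlt⟩ := exists_lt_of_csInf_lt (s := {η | 0 ≤ η ∧ p n η}) (hbdd n)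
      (lt_add_of_pos_right (sInf {η | 0 ≤ η ∧ p n η}) (by positivity : 0 < 1 / ((n : ℝ) + 1)))
    exact hmono n η _ hlt.le hη.2

open Classical in
/-- The gain `ε (a, b, δ)`. Outside of the generic range there are only degenerate graphs. -/
noncomputable def epsilon (a b : ℕ) (δ : ℝ) : ℝ :=
  if 2 ≤ b ∧ b + 3 ≤ a then Real.exp (gain a b δ) - 1
  -- For unions of cliques λ₂ ≥ b + 1, so any positive increasing function at most 1 / (b + 1)
  -- serves. In the last case large graphs do not exist.
  else if a = b + 1 then 1 / ((b : ℝ) + 1) * (1 - 1 / (1 + δ))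
  else δ

lemma epsilon_generic {a b : ℕ} (h : 2 ≤ b ∧ b + 3 ≤ a) (δ : ℝ) :
    epsilon a b δ = Real.exp (gain a b δ) - 1 := if_pos h

lemma epsilon_complete (b : ℕ) (δ : ℝ) :
    epsilon (b + 1) b δ = 1 / ((b : ℝ) + 1) * (1 - 1 / (1 + δ)) := by
  rw [epsilon, if_neg (by omega), if_pos rfl]

lemma epsilon_other {a b : ℕ} (h : ¬ (2 ≤ b ∧ b + 3 ≤ a)) (h' : a ≠ b + 1) (δ : ℝ) :
    epsilon a b δ = δ := by
  rw [epsilon, if_neg h, if_neg h']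

lemma epsilon_pos {a b : ℕ} {δ : ℝ} (hδ : 0 < δ) : 0 < epsilon a b δ := by
  by_cases h : 2 ≤ b ∧ b + 3 ≤ a
  · rw [epsilon_generic h, sub_pos, Real.one_lt_exp_iff]
    exact gain_pos (by omega) h.2 hδ
  by_cases h' : a = b + 1
  · subst h'
    rw [epsilon_complete]
    have : 1 / (1 + δ) < 1 := by rw [div_lt_one (by linarith)]; linarith
    exact mul_pos (by positivity) (by linarith)
  · rwa [epsilon_other h h']

lemma epsilon_strictMonoOn_large {a b : ℕ} (ha : b ^ 2 + 5 * b + 5 ≤ a) :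
    StrictMonoOn (epsilon a b) (Set.Ioc 0 (b : ℝ)) := by
  intro δ₁ h₁ δ₂ h₂ hlt
  have hab : b + 3 ≤ a := by nlinarith
  by_cases h : 2 ≤ b ∧ b + 3 ≤ a
  · rw [epsilon_generic h, epsilon_generic h]
    exact sub_lt_sub_right (Real.exp_lt_exp.2 (gain_lt_gain (by omega) hab h₁.1 hlt
      (mul_min_le_cap ha h₂.2))) 1
  · rwa [epsilon_other h (by omega), epsilon_other h (by omega)]

lemma exists_epsilon_strictMonoOn (a b : ℕ) :
    ∃ δ₀ : ℝ, 0 < δ₀ ∧ StrictMonoOn (epsilon a b) (Set.Ioo 0 δ₀) := by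
  by_cases h : 2 ≤ b ∧ b + 3 ≤ a
  · have hm := minDegree_pos (a := a) (b := b) (by omega)
    have hb : (0 : ℝ) < b := by exact_mod_cast (by omega : 0 < b)
    refine ⟨_, div_pos (cap_pos hb (one_lt_cParam h.2)) hm, fun δ₁ h₁ δ₂ h₂ hlt => ?_⟩
    rw [epsilon_generic h, epsilon_generic h]
    refine sub_lt_sub_right (Real.exp_lt_exp.2 (gain_lt_gain (by omega) h.2 h₁.1 hlt ?_)) 1
    exact (le_div_iff₀ hm).1 h₂.2.le
  refine ⟨1, one_pos, fun δ₁ h₁ δ₂ h₂ hlt => ?_⟩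
  by_cases h' : a = b + 1
  · subst h'
    rw [epsilon_complete, epsilon_complete]
    have h10 := h₁.1
    have : 1 / (1 + δ₂) < 1 / (1 + δ₁) := one_div_lt_one_div_of_lt (by linarith) (by linarith)
    exact mul_lt_mul_of_pos_left (by linarith) (by positivity)
  · rwa [epsilon_other h h', epsilon_other h h']

lemma eventually_bound {a b : ℕ} (hab : b < a) {δ : ℝ} (hδ : 0 < δ) {η : ℝ} (hη : 0 < η) :
    ∃ N : ℕ, ∀ n, N ≤ n → ∀ (V : Type*) [Fintype V] (G : SimpleGraph V), Fintype.card V = n →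
      IsABRegular G a b → LinksExpand G δ → (a = b + 2 → G.Connected) →
      ((b : ℝ) + 2 * √((a : ℝ) - b - 1)) * (1 + epsilon a b δ) - η ≤ secondEigenvalue G := by
  by_cases h : 2 ≤ b ∧ b + 3 ≤ a
  · obtain ⟨N, hN⟩ := eventually_le_secondEigenvalue h.1 h.2 hδ hη
    refine ⟨N, fun n hn V _ G hV hG hexp _ => ?_⟩
    rw [epsilon_generic h, add_sub_cancel]
    exact hN V G (by omega) hG hexp
  by_cases h' : a = b + 1
  · subst h'
    refine ⟨b + 3, fun n hn V _ G hV hG _ _ => ?_⟩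
    refine le_trans ?_ (le_secondEigenvalue_of_complete_links hG (by omega))
    rw [epsilon_complete]
    push_cast
    rw [show (b : ℝ) + 1 - b - 1 = 0 by ring, Real.sqrt_zero, mul_zero, add_zero, mul_add, mul_one]
    have h₁ : 0 ≤ 1 / (1 + δ) := by positivity
    have h₂ : (b : ℝ) * (1 / ((b : ℝ) + 1)) ≤ 1 := by
      rw [mul_one_div, div_le_one (by positivity)]; linarith
    have h₃ : 0 ≤ (b : ℝ) * (1 / ((b : ℝ) + 1)) := by positivity
    nlinarith
  refine ⟨2 * b + 6, fun n hn V _ G hV hG hexp hconn => ?_⟩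
  exfalso
  by_cases hb : b ≤ 1
  · have := hexp.isEmpty hG hδ hb (by omega)
    have := Fintype.card_eq_zero (α := V)
    omega
  · obtain rfl : a = b + 2 := by omega
    have := card_le_of_cocktailParty_links hG (by omega) (hconn rfl)
    omega

end LocalGlobal

theorem theorem2 :
    ∃ ε : ℕ → ℕ → ℝ → ℝ,
      -- positivity and the lower bound on the second eigenvalue
      (∀ a b : ℕ, b < a → ∀ δ : ℝ, 0 < δ →
        0 < ε a b δ ∧
        ∃ o : ℕ → ℝ, Filter.Tendsto o Filter.atTop (nhds 0) ∧
          ∀ (V : Type u) [Fintype V] (G : SimpleGraph V),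
            LocalGlobal.IsABRegular G a b → LocalGlobal.LinksExpand G δ →
            (a = b + 2 → G.Connected) →
            ((b : ℝ) + 2 * √((a : ℝ) - b - 1)) * (1 + ε a b δ) - o (Fintype.card V)
              ≤ LocalGlobal.secondEigenvalue G) ∧
      -- the value of `ε` outside the degenerate ranges
      (∀ a b : ℕ, 2 ≤ b → b + 3 ≤ a → ∀ δ : ℝ, 0 < δ →
        ε a b δ = Real.exp (LocalGlobal.gain a b δ) - 1) ∧
      -- monotonicity in `δ` for large `a`; links that are `b`-regular on at least two vertices
      -- have edge expansion at most `b`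
      (∀ a b : ℕ, b ^ 2 + 5 * b + 5 ≤ a → StrictMonoOn (ε a b) (Set.Ioc 0 (b : ℝ))) ∧
      -- monotonicity for small `δ`
      (∀ a b : ℕ, b < a → ∃ δ₀ : ℝ, 0 < δ₀ ∧ StrictMonoOn (ε a b) (Set.Ioo 0 δ₀)) := by
  refine ⟨LocalGlobal.epsilon, fun a b hab δ hδ => ⟨LocalGlobal.epsilon_pos hδ, ?_⟩,
    fun a b hb ha δ _ => LocalGlobal.epsilon_generic ⟨hb, ha⟩ δ,
    fun a b ha => LocalGlobal.epsilon_strictMonoOn_large ha,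
    fun a b _ => LocalGlobal.exists_epsilon_strictMonoOn a b⟩
  obtain ⟨o, ho, hbound⟩ := LocalGlobal.exists_tendsto_zero_of_eventually
    (p := fun n η => ∀ (V : Type u) [Fintype V] (G : SimpleGraph V), Fintype.card V = n →
      LocalGlobal.IsABRegular G a b → LocalGlobal.LinksExpand G δ → (a = b + 2 → G.Connected) →
      ((b : ℝ) + 2 * √((a : ℝ) - b - 1)) * (1 + LocalGlobal.epsilon a b δ) - η
        ≤ LocalGlobal.secondEigenvalue G)
    (fun n η η' hle h V _ G hV hG hexp hconn => by linarith [h V G hV hG hexp hconn])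
    (fun n => by
      refine ⟨max 0 (((b : ℝ) + 2 * √((a : ℝ) - b - 1)) * (1 + LocalGlobal.epsilon a b δ) + n),
        le_max_left _ _, fun V _ G hV _ _ _ => ?_⟩
      have h₁ := LocalGlobal.neg_card_le_secondEigenvalue G
      rw [hV] at h₁
      have h₂ := le_max_right 0
        (((b : ℝ) + 2 * √((a : ℝ) - b - 1)) * (1 + LocalGlobal.epsilon a b δ) + n)
      linarith)
    (fun η hη => LocalGlobal.eventually_bound hab hδ hη)
  exact ⟨o, ho, fun V _ G hG hexp hconn => hbound _ V G rfl hG hexp hconn⟩
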